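/- **Setting.** Let $\Omega\subset\mathbb{R}^2$ be a bounded polygonal Lipschitz domain with boundary $\Gamma$ and exterior unit normal $n$ (defined at all boundary points except finitely many corners) and unit tangential vector $t$ along $\Gamma$. Let $\mathcal T$ be a finite regular (conforming) triangulation of $\Omega$ by non-degenerate triangles $T$. Let $\Gamma_{hc},\Gamma_{sc},\Gamma_{ss},\Gamma_{sf}\subset\Gamma$ be disjoint, relatively open (possibly empty) pieces with $\Gamma=\mathrm{closure}(\Gamma_{hc}\cup\Gamma_{sc}\cup\Gamma_{ss}\cup\Gamma_{sf})$ that cover $\Gamma$ up to a set of zero length. Let $\mathbb S$ denote the symmetric real $2\times2$ matrices, $(\cdot,\cdot)$ and $\|\cdot\|$ the $L_2(\Omega)$ inner products and norms (Frobenius product for tensors), $\varepsilon(v)=(\nabla v+\nabla v^{\mathsf T})/2$, and $(v_1,v_2)^\perp=(v_2,-v_1)$. Derivatives are weak ones, $\operatorname{div}$ of a tensor is taken row-wise, and boundary values of $H^1(\Omega;\mathbb R^2)$ functions are traces. Let * $H^1(\mathcal T)$ be the space of scalar $z\in L_2(\Omega)$ with $z|_T\in H^1(T)$ for all $T\in\mathcal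 T$, with piecewise $\operatorname{curl}_{\mathcal T}z=(\nabla_{\mathcal T} z)^\perp$; * $H(\operatorname{div},\mathcal T;\mathbb S)$ be the space of $\tau\in L_2(\Omega;\mathbb S)$ with $\operatorname{div}(\tau|_T)\in L_2(T;\mathbb R^2)$ for all $T\in\mathcal T$, with piecewise divergence $\operatorname{div}_{\mathcal T}\tau$ and norm $\|\tau\|_{\operatorname{div},\mathcal T}=(\|\tau\|^2+\|\operatorname{div}_{\mathcal T}\tau\|^2)^{1/2}$; * $\langle\gamma(v),\tau\rangle_{\mathcal S}:=(\varepsilon(v),\tau)+(v,\operatorname{div}_{\mathcal T}\tau)$ for $v\in H^1(\Omega;\mathbb R^2)$, $\tau\in H(\operatorname{div},\mathcal T;\mathbb S)$; * $\langle\gamma_t(v),z\rangle_{\mathcal S}:=(\operatorname{rot}v,z)-(v,\operatorname{curl}_{\mathcal T}z)$ for $v\in H^1(\Omega;\mathbb R^2)$, $z\in H^1(\mathcal T)$, where $\operatorname{rot}v=\partial_1v_2-\partial_2v_1$; * $H_{nn}(\operatorname{div},\mathcal T;\mathbb S):=\{\tau\in H(\operatorname{div},\mathcal T;\mathbb S):\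 \langle\gamma(v),\tau\rangle_{\mathcal S}=0\ \text{for all } v\in H^1_0(\Omega;\mathbb R^2)\text{ with }\gamma_t(v)=0\}$ (tensors with continuous normal-normal traces); * $\gamma_{1,nn}(v)\in H_{nn}(\operatorname{div},\mathcal T;\mathbb S)^*$ be the restriction of the functional $\gamma(v)$ to $H_{nn}(\operatorname{div},\mathcal T;\mathbb S)$, for $v\in H^1(\Omega;\mathbb R^2)$; * $H^1_D(\Omega;\mathbb R^2):=\{v\in H^1(\Omega;\mathbb R^2):\ v|_{\Gamma_{hc}}=0,\ v\cdot n|_{\Gamma_{sc}}=0,\ v\cdot t|_{\Gamma_{ss}}=0\}$; * $H^{1/2}_t(\mathcal S;\mathbb R^2):=\gamma_{1,nn}(H^1(\Omega;\mathbb R^2))$ and $H^{1/2}_{D,t}(\mathcal S;\mathbb R^2):=\gamma_{1,nn}(H^1_D(\Omega;\mathbb R^2))$; * $\|\rho\|_{1/2,t,\mathcal S}:=\inf\{(\|v\|^2+\|\varepsilon(v)\|^2)^{1/2}:\ v\in H^1(\Omega;\mathbb R^2),\ \gamma_{1,nn}(v)=\rho\}$ for $\rho\in H^{1/2}_t(\mathcal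 S;\mathbb R^2)$ (minimal extension norm). For $\rho\in H^{1/2}_t(\mathcal S;\mathbb R^2)$ and $\tau\in H_{nn}(\operatorname{div},\mathcal T;\mathbb S)$ write $\langle\rho,\tau\rangle_{\mathcal S}:=\rho(\tau)$. **Proposition.** Any $\rho\in H^{1/2}_t(\mathcal S;\mathbb R^2)$ satisfies $$\|\rho\|_{1/2,t,\mathcal S}=\sup_{0\ne\tau\in H_{nn}(\operatorname{div},\mathcal T;\mathbb S)}\frac{\langle\rho,\tau\rangle_{\mathcal S}}{\|\tau\|_{\operatorname{div},\mathcal T}}.$$ If $\Gamma_{ss}\cup\Gamma_{sf}=\emptyset$ and $\rho\in H^{1/2}_{D,t}(\mathcal S;\mathbb R^2)$, then the same relation holds with the supremum taken over all $\tau\in H_{nn}(\operatorname{div},\mathcal T;\mathbb S)\setminus\{0\}$ with $\int_\Omega\operatorname{tr}(\tau)\,dx=0$. -/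

import Mathlib

open MeasureTheory Set Metric
open scoped ContDiff ENNReal

noncomputable section

namespace Elast

/-! ### Values: vectors and tensors -/

/-- Points and vectors of the Euclidean plane. -/
abbrev Vec : Type := EuclideanSpace ℝ (Fin 2)

/-- Real `2 × 2` tensors, entries indexed by `(row, column)`, with the Frobenius inner product. -/
abbrev Mat : Type := EuclideanSpace ℝ (Fin 2 × Fin 2)

/-- The transpose of a tensor. -/
def transposeL : Mat →L[ℝ] Mat :=
  LinearMap.toContinuousLinearMap
    { toFun := fun A => WithLp.toLp 2 (fun p : Fin 2 × Fin 2 => A (p.2, p.1))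
      map_add' := fun _ _ => by ext; simp
      map_smul' := fun _ _ => by ext; simp }

/-- The symmetric part `(A + Aᵀ) / 2`. -/
def symL : Mat →L[ℝ] Mat := (1 / 2 : ℝ) • (ContinuousLinearMap.id ℝ Mat + transposeL)

/-- The trace `A₁₁ + A₂₂`. -/
def trL : Mat →L[ℝ] ℝ :=
  EuclideanSpace.proj ((0, 0) : Fin 2 × Fin 2) + EuclideanSpace.proj ((1, 1) : Fin 2 × Fin 2)

/-- `A₂₁ - A₁₂`; applied to a gradient `∇v` (entries `∂ⱼ vᵢ`) this is `rot v = ∂₁v₂ - ∂₂v₁`. -/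
def rotL : Mat →L[ℝ] ℝ :=
  EuclideanSpace.proj ((1, 0) : Fin 2 × Fin 2) - EuclideanSpace.proj ((0, 1) : Fin 2 × Fin 2)

/-- `v^⊥ = (v₂, -v₁)`. -/
def perpL : Vec →L[ℝ] Vec :=
  LinearMap.toContinuousLinearMap
    { toFun := fun v => !₂[v 1, -v 0]
      map_add' := fun v w => by ext i; fin_cases i <;> simp [add_comm]
      map_smul' := fun c v => by ext i; fin_cases i <;> simp }

/-! ### The domain, its boundary and the mesh -/

/-- A bounded polygonal Lipschitz domain: a bounded, open, connected, non-empty set that is locally,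
after a rigid motion, the region below the graph of a Lipschitz function, and whose boundary is
a finite union of line segments. -/
structure IsPolygonalLipschitzDomain (Ω : Set Vec) : Prop where
  isOpen : IsOpen Ω
  isConnected : IsConnected Ω
  isBounded : Bornology.IsBounded Ω
  lipschitz : ∀ x ∈ frontier Ω, ∃ r > 0, ∃ L : Vec ≃ₗᵢ[ℝ] Vec, ∃ c : NNReal, ∃ f : ℝ → ℝ,
    LipschitzWith c f ∧ ∀ y ∈ ball x r, y ∈ Ω ↔ (L y) 1 < f ((L y) 0)
  polygonal : ∃ S : Set (Vec × Vec), S.Finite ∧ frontier Ω = ⋃ p ∈ S, segment ℝ p.1 p.2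

/-- `K` is a regular (conforming) triangulation of `Ω`: a finite simplicial complex, each of whose
vertices and edges belongs to a (non-degenerate) triangle, and whose triangles
cover the closure of `Ω`. -/
structure IsTriangulation (K : Geometry.SimplicialComplex ℝ Vec) (Ω : Set Vec) : Prop where
  finite : K.faces.Finite
  pure : ∀ s ∈ K.faces, ∃ t ∈ K.faces, s ⊆ t ∧ t.card = 3
  space_eq : K.space = closure Ω

/-- The open triangles of the mesh. -/
def openTriangles (K : Geometry.SimplicialComplex ℝ Vec) : Set (Set Vec) :=
  {T | ∃ s ∈ K.faces, s.card = 3 ∧ T = interior (convexHull ℝ (s : Set Vec))}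

/-- `ν` is the exterior unit normal at the boundary point `x` of `Ω`: near `x`, the set `Ω` is the
half-plane with exterior normal `ν`. For a polygonal Lipschitz domain such a `ν` exists (and is
unique) at all boundary points except for finitely many corners. -/
def IsOuterNormal (Ω : Set Vec) (x ν : Vec) : Prop :=
  ‖ν‖ = 1 ∧ ∃ r > 0, ∀ y ∈ ball x r, y ∈ Ω ↔ inner ℝ (y - x) ν < 0

open Classical in
/-- The exterior unit normal field on the boundary of `Ω` (zero where there is none). -/
def outerNormal (Ω : Set Vec) (x : Vec) : Vec :=
  if h : ∃ ν, IsOuterNormal Ω x ν then h.choose else 0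

/-- The boundary of `Ω` is decomposed into disjoint relatively open pieces (hard clamped, soft
clamped, simply supported, stress free), whose closures cover the boundary. The part of the boundary
that is left out has zero length; this holds whenever the pieces have
finitely many connected components. -/
structure IsBoundaryDecomposition (Ω Γhc Γsc Γss Γsf : Set Vec) : Prop where
  hc_open : ∃ U, IsOpen U ∧ Γhc = U ∩ frontier Ω
  sc_open : ∃ U, IsOpen U ∧ Γsc = U ∩ frontier Ω
  ss_open : ∃ U, IsOpen U ∧ Γss = U ∩ frontier Ω
  sf_open : ∃ U, IsOpen U ∧ Γsf = U ∩ frontier Ω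
  disjoint_hc_sc : Disjoint Γhc Γsc
  disjoint_hc_ss : Disjoint Γhc Γss
  disjoint_hc_sf : Disjoint Γhc Γsf
  disjoint_sc_ss : Disjoint Γsc Γss
  disjoint_sc_sf : Disjoint Γsc Γsf
  disjoint_ss_sf : Disjoint Γss Γsf
  closure_eq : closure (Γhc ∪ Γsc ∪ Γss ∪ Γsf) = frontier Ω
  null : Measure.hausdorffMeasure 1 (frontier Ω \ (Γhc ∪ Γsc ∪ Γss ∪ Γsf)) = 0

/-! ### Weak derivatives -/

/-- The space `L₂(Ω; F)`. -/
abbrev L2 (Ω : Set Vec) (F : Type) [NormedAddCommGroup F] : Type :=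
  Lp F 2 (volume.restrict Ω)

/-- `φ ∈ C_c^∞(U)`. -/
def IsTest (U : Set Vec) (φ : Vec → ℝ) : Prop :=
  ContDiff ℝ ∞ φ ∧ HasCompactSupport φ ∧ tsupport φ ⊆ U

/-- The classical partial derivative `∂ⱼ φ`. -/
def pd (j : Fin 2) (φ : Vec → ℝ) (x : Vec) : ℝ := fderiv ℝ φ x (EuclideanSpace.single j 1)

/-- On `U ⊆ Ω` the function `g` is the weak partial derivative `∂ⱼ f`. -/
def IsWeakPartial (Ω U : Set Vec) (j : Fin 2) (f g : Vec → ℝ) : Prop :=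
  ∀ φ, IsTest U φ → ∫ x in Ω, f x * pd j φ x = - ∫ x in Ω, g x * φ x

/-- On `U ⊆ Ω` the function `d` is the weak divergence of the vector field `F`. -/
def IsWeakDiv (Ω U : Set Vec) (F : Fin 2 → Vec → ℝ) (d : Vec → ℝ) : Prop :=
  ∀ φ, IsTest U φ → ∫ x in Ω, (∑ j, F j x * pd j φ x) = - ∫ x in Ω, d x * φ x

section closure_properties

variable {Ω U : Set Vec}

lemma IsTest.memLp {φ : Vec → ℝ} (h : IsTest U φ) : MemLp φ 2 (volume.restrict Ω) :=
  (h.1.continuous.memLp_of_hasCompactSupport h.2.1).restrict Ω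

lemma IsTest.memLp_pd {φ : Vec → ℝ} (h : IsTest U φ) (j : Fin 2) :
    MemLp (pd j φ) 2 (volume.restrict Ω) := by
  have hc : Continuous (pd j φ) :=
    (h.1.continuous_fderiv (by simp)).clm_apply continuous_const
  have hs : HasCompactSupport (pd j φ) := h.2.1.fderiv_apply (𝕜 := ℝ) _
  exact (hc.memLp_of_hasCompactSupport hs).restrict Ω

lemma IsWeakPartial.congr {j : Fin 2} {f g f' g' : Vec → ℝ} (h : IsWeakPartial Ω U j f g)
    (hf : f' =ᵐ[volume.restrict Ω] f) (hg : g' =ᵐ[volume.restrict Ω] g) :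
    IsWeakPartial Ω U j f' g' := by
  intro φ hφ
  have h1 : (fun x => f' x * pd j φ x) =ᵐ[volume.restrict Ω] fun x => f x * pd j φ x := by
    filter_upwards [hf] with x hx
    rw [hx]
  have h2 : (fun x => g' x * φ x) =ᵐ[volume.restrict Ω] fun x => g x * φ x := by
    filter_upwards [hg] with x hx
    rw [hx]
  rw [integral_congr_ae h1, integral_congr_ae h2]
  exact h φ hφ

lemma IsWeakDiv.congr {F F' : Fin 2 → Vec → ℝ} {d d' : Vec → ℝ} (h : IsWeakDiv Ω U F d)
    (hF : ∀ j, F' j =ᵐ[volume.restrict Ω] F j) (hd : d' =ᵐ[volume.restrict Ω] d) :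
    IsWeakDiv Ω U F' d' := by
  intro φ hφ
  have h1 : (fun x => ∑ j, F' j x * pd j φ x) =ᵐ[volume.restrict Ω]
      fun x => ∑ j, F j x * pd j φ x := by
    filter_upwards [hF 0, hF 1] with x h0 h1
    simp [Fin.sum_univ_two, h0, h1]
  have h2 : (fun x => d' x * φ x) =ᵐ[volume.restrict Ω] fun x => d x * φ x := by
    filter_upwards [hd] with x hx
    rw [hx]
  rw [integral_congr_ae h1, integral_congr_ae h2]
  exact h φ hφ

lemma IsWeakDiv.zero : IsWeakDiv Ω U (fun _ _ => 0) (fun _ => 0) := by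
  intro φ _
  simp

lemma IsWeakDiv.add {F F' : Fin 2 → Vec → ℝ} {d d' : Vec → ℝ}
    (h : IsWeakDiv Ω U F d) (h' : IsWeakDiv Ω U F' d')
    (hF : ∀ j, MemLp (F j) 2 (volume.restrict Ω)) (hF' : ∀ j, MemLp (F' j) 2 (volume.restrict Ω))
    (hd : MemLp d 2 (volume.restrict Ω)) (hd' : MemLp d' 2 (volume.restrict Ω)) :
    IsWeakDiv Ω U (fun j x => F j x + F' j x) (fun x => d x + d' x) := by
  intro φ hφ
  have e1 : (fun x => ∑ j, (F j x + F' j x) * pd j φ x) =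
      fun x => (∑ j, F j x * pd j φ x) + ∑ j, F' j x * pd j φ x := by
    ext x; simp only [Fin.sum_univ_two]; ring
  have e2 : (fun x => (d x + d' x) * φ x) = fun x => d x * φ x + d' x * φ x := by
    ext x; ring
  rw [e1, e2, integral_add, integral_add, h φ hφ, h' φ hφ]
  · ring
  · exact hd.integrable_mul hφ.memLp
  · exact hd'.integrable_mul hφ.memLp
  · exact integrable_finsetSum _ fun j _ => (hF j).integrable_mul (hφ.memLp_pd j)
  · exact integrable_finsetSum _ fun j _ => (hF' j).integrable_mul (hφ.memLp_pd j)

lemma IsWeakDiv.smul {F : Fin 2 → Vec → ℝ} {d : Vec → ℝ} (h : IsWeakDiv Ω U F d) (c : ℝ) :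
    IsWeakDiv Ω U (fun j x => c * F j x) (fun x => c * d x) := by
  intro φ hφ
  have e1 : (fun x => ∑ j, c * F j x * pd j φ x) = fun x => c * ∑ j, F j x * pd j φ x := by
    ext x; simp only [Fin.sum_univ_two]; ring
  have e2 : (fun x => c * d x * φ x) = fun x => c * (d x * φ x) := by
    ext x; ring
  rw [e1, e2, integral_const_mul, integral_const_mul, h φ hφ]
  ring

lemma IsWeakPartial.zero {j : Fin 2} : IsWeakPartial Ω U j (fun _ => 0) (fun _ => 0) := by
  intro φ _
  simp

lemma IsWeakPartial.add {j : Fin 2} {f f' g g' : Vec → ℝ}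
    (h : IsWeakPartial Ω U j f g) (h' : IsWeakPartial Ω U j f' g')
    (hf : MemLp f 2 (volume.restrict Ω)) (hf' : MemLp f' 2 (volume.restrict Ω))
    (hg : MemLp g 2 (volume.restrict Ω)) (hg' : MemLp g' 2 (volume.restrict Ω)) :
    IsWeakPartial Ω U j (fun x => f x + f' x) (fun x => g x + g' x) := by
  intro φ hφ
  simp only [add_mul]
  rw [integral_add, integral_add, h φ hφ, h' φ hφ]
  · ring
  · exact hg.integrable_mul hφ.memLp
  · exact hg'.integrable_mul hφ.memLp
  · exact hf.integrable_mul (hφ.memLp_pd j)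
  · exact hf'.integrable_mul (hφ.memLp_pd j)

lemma IsWeakPartial.smul {j : Fin 2} {f g : Vec → ℝ} (h : IsWeakPartial Ω U j f g) (c : ℝ) :
    IsWeakPartial Ω U j (fun x => c * f x) (fun x => c * g x) := by
  intro φ hφ
  simp only [mul_assoc]
  rw [integral_const_mul, integral_const_mul, h φ hφ]
  ring

lemma memLp_coord {ι : Type} [Fintype ι] (f : L2 Ω (EuclideanSpace ℝ ι)) (i : ι) :
    MemLp (fun x => f x i) 2 (volume.restrict Ω) :=
  (EuclideanSpace.proj i : EuclideanSpace ℝ ι →L[ℝ] ℝ).comp_memLp' (Lp.memLp f)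

lemma coord_zero {ι : Type} [Fintype ι] (i : ι) :
    (fun x => (0 : L2 Ω (EuclideanSpace ℝ ι)) x i) =ᵐ[volume.restrict Ω] fun _ => 0 := by
  filter_upwards [Lp.coeFn_zero (EuclideanSpace ℝ ι) 2 (volume.restrict Ω)] with x hx
  rw [hx]
  rfl

lemma coord_add {ι : Type} [Fintype ι] (f g : L2 Ω (EuclideanSpace ℝ ι)) (i : ι) :
    (fun x => (f + g) x i) =ᵐ[volume.restrict Ω] fun x => f x i + g x i := by
  filter_upwards [Lp.coeFn_add f g] with x hx
  rw [hx]
  rfl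

lemma coord_smul {ι : Type} [Fintype ι] (c : ℝ) (f : L2 Ω (EuclideanSpace ℝ ι)) (i : ι) :
    (fun x => (c • f) x i) =ᵐ[volume.restrict Ω] fun x => c * f x i := by
  filter_upwards [Lp.coeFn_smul c f] with x hx
  rw [hx]
  rfl

end closure_properties

/-! ### Function spaces

A function is stored together with its weak derivative, which it determines almost everywhere. -/

/-- `H¹(Ω; ℝ²)`: pairs `(v, ∇v)` of square integrable functions, `(∇v)ᵢⱼ = ∂ⱼ vᵢ` weakly in `Ω`. -/
def H1 (Ω : Set Vec) : Submodule ℝ (WithLp 2 (L2 Ω Vec × L2 Ω Mat)) where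
  carrier := {p | ∀ i j, IsWeakPartial Ω Ω j (fun x => p.fst x i) (fun x => p.snd x (i, j))}
  zero_mem' := fun i j => IsWeakPartial.zero.congr (coord_zero i) (coord_zero (i, j))
  add_mem' := fun {p q} hp hq i j =>
    ((hp i j).add (hq i j) (memLp_coord _ _) (memLp_coord _ _) (memLp_coord _ _)
      (memLp_coord _ _)).congr (coord_add p.fst q.fst i) (coord_add p.snd q.snd (i, j))
  smul_mem' := fun c p hp i j =>
    ((hp i j).smul c).congr (coord_smul c p.fst i) (coord_smul c p.snd (i, j))

/-- The broken space `H¹(𝒯)` of scalar functions: pairs `(z, ∇_𝒯 z)` of square integrable functions,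
the second one being the weak gradient of the first one in each open triangle of the mesh. -/
def H1T (Ω : Set Vec) (K : Geometry.SimplicialComplex ℝ Vec) :
    Submodule ℝ (WithLp 2 (L2 Ω ℝ × L2 Ω Vec)) where
  carrier := {p | ∀ T ∈ openTriangles K, ∀ j,
    IsWeakPartial Ω T j (fun x => p.fst x) (fun x => p.snd x j)}
  zero_mem' := fun _ _ j =>
    IsWeakPartial.zero.congr (Lp.coeFn_zero ℝ 2 (volume.restrict Ω)) (coord_zero j)
  add_mem' := fun {p q} hp hq T hT j =>
    ((hp T hT j).add (hq T hT j) (Lp.memLp _) (Lp.memLp _) (memLp_coord _ _)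
      (memLp_coord _ _)).congr (Lp.coeFn_add p.fst q.fst) (coord_add p.snd q.snd j)
  smul_mem' := fun c p hp T hT j =>
    ((hp T hT j).smul c).congr (Lp.coeFn_smul c p.fst) (coord_smul c p.snd j)

/-- `H(div, 𝒯; 𝕊)`: pairs `(τ, div_𝒯 τ)` of square integrable functions, with `τ` pointwise symmetric
and the second one being the (row-wise) weak divergence of `τ` in each open triangle of the mesh.
The norm inherited from `L₂(Ω; ℝ²ˣ²) × L₂(Ω; ℝ²)` is
`‖τ‖_{div,𝒯} = (‖τ‖² + ‖div_𝒯 τ‖²)^{1/2}`. -/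
def HdivT (Ω : Set Vec) (K : Geometry.SimplicialComplex ℝ Vec) :
    Submodule ℝ (WithLp 2 (L2 Ω Mat × L2 Ω Vec)) where
  carrier := {p | (∀ᵐ x ∂(volume.restrict Ω), ∀ i j, p.fst x (i, j) = p.fst x (j, i)) ∧
    ∀ T ∈ openTriangles K, ∀ i,
      IsWeakDiv Ω T (fun j x => p.fst x (i, j)) (fun x => p.snd x i)}
  zero_mem' := by
    refine ⟨?_, fun _ _ i => IsWeakDiv.zero.congr (fun j => coord_zero (i, j)) (coord_zero i)⟩
    filter_upwards [Lp.coeFn_zero Mat 2 (volume.restrict Ω)] with x hx i j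
    change (0 : L2 Ω Mat) x (i, j) = (0 : L2 Ω Mat) x (j, i)
    rw [hx]
    rfl
  add_mem' := by
    intro p q hp hq
    refine ⟨?_, fun T hT i => ((hp.2 T hT i).add (hq.2 T hT i) (fun _ => memLp_coord _ _)
      (fun _ => memLp_coord _ _) (memLp_coord _ _) (memLp_coord _ _)).congr
      (fun j => coord_add p.fst q.fst (i, j)) (coord_add p.snd q.snd i)⟩
    filter_upwards [hp.1, hq.1, Lp.coeFn_add p.fst q.fst] with x h1 h2 h3 i j
    change (p.fst + q.fst) x (i, j) = (p.fst + q.fst) x (j, i)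
    rw [h3]
    exact congrArg₂ (· + ·) (h1 i j) (h2 i j)
  smul_mem' := by
    intro c p hp
    refine ⟨?_, fun T hT i => ((hp.2 T hT i).smul c).congr
      (fun j => coord_smul c p.fst (i, j)) (coord_smul c p.snd i)⟩
    filter_upwards [hp.1, Lp.coeFn_smul c p.fst] with x h1 h3 i j
    change (c • p.fst) x (i, j) = (c • p.fst) x (j, i)
    rw [h3]
    exact congrArg (c * ·) (h1 i j)

section operators

variable {Ω : Set Vec} {K : Geometry.SimplicialComplex ℝ Vec}

/-- The function `v` itself. -/
def H1.val : H1 Ω →L[ℝ] L2 Ω Vec := (WithLp.fstL 2 ℝ _ _).comp (H1 Ω).subtypeL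

/-- The gradient `∇v`. -/
def H1.grad : H1 Ω →L[ℝ] L2 Ω Mat := (WithLp.sndL 2 ℝ _ _).comp (H1 Ω).subtypeL

/-- The strain `ε(v) = (∇v + ∇vᵀ) / 2`. -/
def H1.strain : H1 Ω →L[ℝ] L2 Ω Mat := (symL.compLpL 2 (volume.restrict Ω)).comp H1.grad

/-- `rot v = ∂₁v₂ - ∂₂v₁`. -/
def H1.rot : H1 Ω →L[ℝ] L2 Ω ℝ := (rotL.compLpL 2 (volume.restrict Ω)).comp H1.grad

/-- The norm `‖v‖₁ = (‖v‖² + ‖ε(v)‖²)^{1/2}`. -/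
def H1.norm1 (v : H1 Ω) : ℝ := √(‖H1.val v‖ ^ 2 + ‖H1.strain v‖ ^ 2)

/-- The function `z` itself. -/
def H1T.val : H1T Ω K →L[ℝ] L2 Ω ℝ := (WithLp.fstL 2 ℝ _ _).comp (H1T Ω K).subtypeL

/-- The piecewise `curl z = (∇z)^⊥`. -/
def H1T.curl : H1T Ω K →L[ℝ] L2 Ω Vec :=
  (perpL.compLpL 2 (volume.restrict Ω)).comp ((WithLp.sndL 2 ℝ _ _).comp (H1T Ω K).subtypeL)

/-- The tensor `τ` itself. -/
def HdivT.val : HdivT Ω K →L[ℝ] L2 Ω Mat := (WithLp.fstL 2 ℝ _ _).comp (HdivT Ω K).subtypeL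

/-- The piecewise divergence `div_𝒯 τ`. -/
def HdivT.div : HdivT Ω K →L[ℝ] L2 Ω Vec := (WithLp.sndL 2 ℝ _ _).comp (HdivT Ω K).subtypeL

end operators

/-! ### Boundary traces of `H¹` functions -/

/-- `g ∈ L₂(Γ; ℝ²)` is the trace of `v ∈ H¹(Ω; ℝ²)` on the boundary `Γ` of `Ω`, i.e., Green's formula
`∫_Ω ∇v : Ψ + ∫_Ω v · div Ψ = ∫_Γ g · (Ψ n)` holds for all smooth tensor fields `Ψ`
(`Γ` carries the arc length). -/
def IsTrace {Ω : Set Vec} (v : H1 Ω) (g : Vec → Vec) : Prop :=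
  MemLp g 2 ((Measure.hausdorffMeasure 1).restrict (frontier Ω)) ∧
  ∀ Ψ : Vec → Mat, ContDiff ℝ ∞ Ψ →
    (∫ x in Ω, ∑ i, ∑ j, H1.grad v x (i, j) * Ψ x (i, j)) +
      (∫ x in Ω, ∑ i, ∑ j, H1.val v x i * pd j (fun y => Ψ y (i, j)) x) =
    ∫ x in frontier Ω, ∑ i, ∑ j, g x i * Ψ x (i, j) * outerNormal Ω x j
      ∂(Measure.hausdorffMeasure 1)

/-- `H¹₀(Ω; ℝ²)`: the `H¹` functions with zero trace. -/
def H10 (Ω : Set Vec) : Set (H1 Ω) := {v | IsTrace v (fun _ => 0)}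

/-- `H¹_D(Ω; ℝ²)`: the `H¹` functions `v` with `v = 0` on `Γhc`, `v · n = 0` on `Γsc`, and `v · t = 0`
on `Γss`, in the sense of traces. -/
def H1D (Ω Γhc Γsc Γss : Set Vec) : Set (H1 Ω) :=
  {v | ∃ g, IsTrace v g ∧
    (∀ᵐ x ∂((Measure.hausdorffMeasure 1).restrict Γhc), g x = 0) ∧
    (∀ᵐ x ∂((Measure.hausdorffMeasure 1).restrict Γsc), inner ℝ (g x) (outerNormal Ω x) = 0) ∧
    (∀ᵐ x ∂((Measure.hausdorffMeasure 1).restrict Γss),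
      inner ℝ (g x) (perpL (outerNormal Ω x)) = 0)}

/-! ### Trace operators on the skeleton and normal-normal continuous tensors -/

section traces

variable (Ω : Set Vec) (K : Geometry.SimplicialComplex ℝ Vec)

/-- The canonical trace operator `γ : H¹(Ω; ℝ²) → H(div, 𝒯; 𝕊)*`,
`⟨γ(v), τ⟩ = (ε(v), τ) + (v, div_𝒯 τ)`. -/
def gammaTr : H1 Ω →ₗ[ℝ] StrongDual ℝ (HdivT Ω K) where
  toFun v := (innerSL ℝ (H1.strain v)).comp HdivT.val + (innerSL ℝ (H1.val v)).comp HdivT.div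
  map_add' v w := by ext τ; simp; ring
  map_smul' c v := by ext τ; simp

/-- The tangential trace operator `γ_t : H¹(Ω; ℝ²) → H¹(𝒯)*`,
`⟨γ_t(v), z⟩ = (rot v, z) - (v, curl_𝒯 z)`. -/
def gammaT : H1 Ω →ₗ[ℝ] StrongDual ℝ (H1T Ω K) where
  toFun v := (innerSL ℝ (H1.rot v)).comp H1T.val - (innerSL ℝ (H1.val v)).comp H1T.curl
  map_add' v w := by ext τ; simp; ring
  map_smul' c v := by ext τ; simp; ring

/-- `H̃^{1/2}_{0,n}(𝒮; ℝ²) = γ(ker γ_t ∩ H¹₀(Ω; ℝ²))`. -/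
def Htilde0n : Set (StrongDual ℝ (HdivT Ω K)) :=
  gammaTr Ω K '' ((LinearMap.ker (gammaT Ω K) : Set (H1 Ω)) ∩ H10 Ω)

/-- `H_nn(div, 𝒯; 𝕊)`: the tensors in `H(div, 𝒯; 𝕊)` with continuous normal-normal traces, normed
by `‖·‖_{div,𝒯}`. -/
def Hnn : Submodule ℝ (HdivT Ω K) where
  carrier := {τ | ∀ φ ∈ Htilde0n Ω K, φ τ = 0}
  zero_mem' := fun φ _ => map_zero φ
  add_mem' := fun ha hb φ hφ => by rw [map_add, ha φ hφ, hb φ hφ, add_zero]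
  smul_mem' := fun c _ ha φ hφ => by rw [map_smul, ha φ hφ, smul_zero]

/-- The trace operator `γ_{1,nn} : H¹(Ω; ℝ²) → H_nn(div, 𝒯; 𝕊)*`: the functional `γ(v)` restricted to
`H_nn(div, 𝒯; 𝕊)`. -/
def gammaNN : H1 Ω →ₗ[ℝ] StrongDual ℝ (Hnn Ω K) where
  toFun v := (gammaTr Ω K v).comp (Hnn Ω K).subtypeL
  map_add' v w := by ext τ; simp
  map_smul' c v := by ext τ; simp

/-- `H^{1/2}_t(𝒮; ℝ²) = γ_{1,nn}(H¹(Ω; ℝ²))`. -/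
def Ht : Set (StrongDual ℝ (Hnn Ω K)) := Set.range (gammaNN Ω K)

/-- `H^{1/2}_{D,t}(𝒮; ℝ²) = γ_{1,nn}(H¹_D(Ω; ℝ²))`. -/
def HDt (Γhc Γsc Γss : Set Vec) : Set (StrongDual ℝ (Hnn Ω K)) :=
  gammaNN Ω K '' H1D Ω Γhc Γsc Γss

variable {Ω K}

/-- The minimal extension norm `‖ρ‖_{1/2,t,𝒮} = inf {‖v‖₁ : γ_{1,nn}(v) = ρ}`. -/
def minExtNorm (ρ : StrongDual ℝ (Hnn Ω K)) : ℝ :=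
  sInf {r | ∃ v : H1 Ω, gammaNN Ω K v = ρ ∧ r = H1.norm1 v}

end traces

end Elast

end

open Elast

/-! The map `v ↦ (ε(v), v)` into the Hilbert space `L₂ × L₂` turns `H1.norm1` into the Hilbert norm,
and `⟨γ(v), τ⟩` is the inner product of `(ε(v), v)` with `(τ, div τ)`. Hence the minimal extension
norm of `ρ = γ_{1,nn}(v)` is the distance of `(ε(v), v)` to `N`, the image of `ker γ_{1,nn}`. The
bound of the quotients by this norm is Cauchy–Schwarz.

Conversely, let `q` be the part of `(ε(v), v)` orthogonal to the closure of `N`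
(`exists_orthogonal_part`). It realizes the distance, and it is an element of `H_nn`
(`exists_mem_Hnn`): orthogonality to fields `φ eᵢ` supported in one triangle says that its second
component is the piecewise divergence of the first, and orthogonality to `ker γ_t ∩ H¹₀` is
normal-normal continuity. So `q = (τ, div τ)` with `ρ(τ) = ‖τ‖²`, and the supremum is attained
unless `τ = 0`. Neither Korn's inequality nor closedness of `N` is needed.

Without simply supported or free parts, `ρ(I) = ∫_Γ v · n = 0` for the identity tensor `I`, while
`⟨I, τ⟩ = ∫ tr τ`. Removing from `τ` its component along `I` keeps `ρ(τ)` and does not increase the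
norm. -/

noncomputable section

namespace Elast

/-! ### The trace pairing as an inner product in `L₂ × L₂`; symmetric pairs. -/

section strainPair

variable {Ω : Set Vec} {K : Geometry.SimplicialComplex ℝ Vec}

/-- The pair `(ε(v), v)`. -/
def H1.strainPair : H1 Ω →L[ℝ] WithLp 2 (L2 Ω Mat × L2 Ω Vec) :=
  ((WithLp.prodContinuousLinearEquiv 2 ℝ (L2 Ω Mat) (L2 Ω Vec)).symm :
    (L2 Ω Mat × L2 Ω Vec) →L[ℝ] WithLp 2 (L2 Ω Mat × L2 Ω Vec)).comp (H1.strain.prod H1.val)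

lemma H1.strainPair_fst (v : H1 Ω) : (H1.strainPair v).fst = H1.strain v := rfl

lemma H1.strainPair_snd (v : H1 Ω) : (H1.strainPair v).snd = H1.val v := rfl

lemma H1.norm_strainPair (v : H1 Ω) : ‖H1.strainPair v‖ = H1.norm1 v := by
  rw [WithLp.prod_norm_eq_of_L2, H1.norm1, H1.strainPair_fst, H1.strainPair_snd, add_comm]

lemma gammaTr_apply (v : H1 Ω) (τ : HdivT Ω K) :
    gammaTr Ω K v τ =
      inner ℝ (H1.strainPair v) (τ : WithLp 2 (L2 Ω Mat × L2 Ω Vec)) := by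
  rw [WithLp.prod_inner_apply]
  rfl

lemma gammaNN_apply (v : H1 Ω) (τ : Hnn Ω K) :
    gammaNN Ω K v τ =
      inner ℝ (H1.strainPair v) ((τ : HdivT Ω K) : WithLp 2 (L2 Ω Mat × L2 Ω Vec)) := by
  rw [← gammaTr_apply]
  simp only [gammaNN, LinearMap.coe_mk, AddHom.coe_mk, ContinuousLinearMap.comp_apply,
    Submodule.subtypeL_apply]

lemma Hnn.norm_coe (τ : Hnn Ω K) :
    ‖((τ : HdivT Ω K) : WithLp 2 (L2 Ω Mat × L2 Ω Vec))‖ = ‖τ‖ := by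
  rw [Submodule.norm_coe, Submodule.norm_coe]

lemma symL_apply (A : Mat) (i j : Fin 2) :
    symL A (i, j) = 1 / 2 * (A (i, j) + A (j, i)) := rfl

/-- The skew part of `A` is orthogonal to symmetric tensors. -/
lemma inner_symL_of_symm (A B : Mat) (hB : ∀ i j, B (i, j) = B (j, i)) :
    inner ℝ (symL A) B = ∑ i, ∑ j, A (i, j) * B (i, j) := by
  have h := hB 0 1
  simp only [PiLp.inner_apply, Fintype.sum_prod_type, Fin.sum_univ_two, symL_apply, RCLike.inner_apply,
    conj_trivial]
  linear_combination ((A (1, 0) - A (0, 1)) / 2) * h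

lemma symL_eq_self_iff (B : Mat) : symL B = B ↔ ∀ i j, B (i, j) = B (j, i) := by
  constructor
  · intro h i j
    rw [← h, symL_apply, symL_apply, add_comm]
  · intro h
    ext ⟨i, j⟩
    rw [symL_apply, h j i]
    ring

lemma symL_symL (A : Mat) : symL (symL A) = symL A := by
  rw [symL_eq_self_iff]
  intro i j
  rw [symL_apply, symL_apply, add_comm]

lemma inner_strainPair (w : H1 Ω) (p : WithLp 2 (L2 Ω Mat × L2 Ω Vec))
    (hp : ∀ᵐ x ∂(volume.restrict Ω), ∀ i j, p.fst x (i, j) = p.fst x (j, i)) :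
    inner ℝ (H1.strainPair w) p =
      (∫ x in Ω, ∑ i, ∑ j, H1.grad w x (i, j) * p.fst x (i, j)) +
        ∫ x in Ω, ∑ i, H1.val w x i * p.snd x i := by
  rw [WithLp.prod_inner_apply, L2.inner_def, L2.inner_def]
  congr 1
  · apply integral_congr_ae
    filter_upwards [hp, symL.coeFn_compLpL (p := 2) (μ := volume.restrict Ω) (H1.grad w)]
      with x h1 h2
    change inner ℝ ((symL.compLpL 2 (volume.restrict Ω) (H1.grad w)) x) (p.fst x) = _
    rw [h2, inner_symL_of_symm _ _ h1]
  · refine integral_congr_ae (Filter.Eventually.of_forall fun x => ?_)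
    change inner ℝ (H1.val w x) (p.snd x) = _
    simp only [PiLp.inner_apply, RCLike.inner_apply, conj_trivial]
    exact Finset.sum_congr rfl fun i _ => mul_comm _ _

/-- The pairs whose tensor component is symmetric. -/
def symmPairs (Ω : Set Vec) : Submodule ℝ (WithLp 2 (L2 Ω Mat × L2 Ω Vec)) :=
  LinearMap.ker (((symL.compLpL 2 (volume.restrict Ω)) - ContinuousLinearMap.id ℝ (L2 Ω Mat)).comp
    (WithLp.fstL 2 ℝ (L2 Ω Mat) (L2 Ω Vec))).toLinearMap

/-- Closedness ensures that projecting onto the closure of a space of symmetric pairs preserves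
symmetry. -/
lemma isClosed_symmPairs : IsClosed (symmPairs Ω : Set (WithLp 2 (L2 Ω Mat × L2 Ω Vec))) :=
  ContinuousLinearMap.isClosed_ker _

lemma mem_symmPairs {p : WithLp 2 (L2 Ω Mat × L2 Ω Vec)} :
    p ∈ symmPairs Ω ↔ symL.compLpL 2 (volume.restrict Ω) p.fst = p.fst := by
  rw [symmPairs, LinearMap.mem_ker]
  exact sub_eq_zero

lemma mem_symmPairs_iff_ae {p : WithLp 2 (L2 Ω Mat × L2 Ω Vec)} :
    p ∈ symmPairs Ω ↔
      ∀ᵐ x ∂(volume.restrict Ω), ∀ i j, p.fst x (i, j) = p.fst x (j, i) := by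
  have h := symL.coeFn_compLpL (p := 2) (μ := volume.restrict Ω) p.fst
  rw [mem_symmPairs]
  constructor
  · intro hp
    rw [hp] at h
    filter_upwards [h] with x hx
    exact (symL_eq_self_iff _).1 hx.symm
  · intro hp
    refine Lp.ext ?_
    filter_upwards [h, hp] with x hx h'
    rw [hx, (symL_eq_self_iff _).2 h']

lemma H1.strainPair_mem_symmPairs (v : H1 Ω) : H1.strainPair v ∈ symmPairs Ω := by
  rw [mem_symmPairs, H1.strainPair_fst]
  refine Lp.ext ?_
  filter_upwards [symL.coeFn_compLpL (p := 2) (μ := volume.restrict Ω) (H1.strain v),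
    symL.coeFn_compLpL (p := 2) (μ := volume.restrict Ω) (H1.grad v)] with x h1 h2
  have h3 : H1.strain v x = symL (H1.grad v x) := h2
  rw [h1, h3, symL_symL]

end strainPair

/-! ### Test fields, and recognizing elements of `H_nn`. -/

section test_fields

variable {Ω : Set Vec} {K : Geometry.SimplicialComplex ℝ Vec}

lemma integral_mul_pd {φ ψ : Vec → ℝ} (hφ : ContDiff ℝ ∞ φ) (hφc : HasCompactSupport φ)
    (hψ : ContDiff ℝ ∞ ψ) (hψc : HasCompactSupport ψ) (j : Fin 2) :
    ∫ x, φ x * pd j ψ x = - ∫ x, pd j φ x * ψ x := by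
  have hφ' : Continuous (pd j φ) := (hφ.continuous_fderiv (by simp)).clm_apply continuous_const
  have hψ' : Continuous (pd j ψ) := (hψ.continuous_fderiv (by simp)).clm_apply continuous_const
  refine integral_mul_fderiv_eq_neg_fderiv_mul_of_integrable ?_ ?_ ?_ ?_ ?_
  · exact (hφ'.mul hψ.continuous).integrable_of_hasCompactSupport hψc.mul_left
  · exact (hφ.continuous.mul hψ').integrable_of_hasCompactSupport hφc.mul_right
  · exact (hφ.continuous.mul hψ.continuous).integrable_of_hasCompactSupport hψc.mul_left
  · exact fun x _ => hφ.differentiable (by simp) x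
  · exact fun x _ => hψ.differentiable (by simp) x

lemma integral_pd_eq_zero {φ : Vec → ℝ} (hφ : ContDiff ℝ ∞ φ) (hφc : HasCompactSupport φ)
    (j : Fin 2) : ∫ x, pd j φ x = 0 := by
  have hφ' : Continuous (pd j φ) := (hφ.continuous_fderiv (by simp)).clm_apply continuous_const
  have hs : HasCompactSupport (pd j φ) := hφc.fderiv_apply (𝕜 := ℝ) _
  have h := integral_mul_fderiv_eq_neg_fderiv_mul_of_integrable (μ := (volume : Measure Vec))
    (f := fun _ : Vec => (1 : ℝ)) (g := φ) (v := EuclideanSpace.single j 1)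
    (by simp) (by
      simp only [one_mul]
      exact hφ'.integrable_of_hasCompactSupport hs)
    (by simpa using hφ.continuous.integrable_of_hasCompactSupport hφc)
    (by simp) (fun x _ => hφ.differentiable (by simp) x)
  simpa [pd] using h

lemma pd_eq_zero_of_notMem {φ : Vec → ℝ} {x : Vec} (hx : x ∉ tsupport φ) (j : Fin 2) :
    pd j φ x = 0 := by
  rw [pd, fderiv_of_notMem_tsupport (𝕜 := ℝ) hx, zero_apply]

/-- The test function is supported in `Ω`, so both integrals extend to the plane, where integration
by parts has no boundary term. -/
lemma isWeakPartial_of_contDiff {φ : Vec → ℝ} (hφ : ContDiff ℝ ∞ φ) (hφc : HasCompactSupport φ)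
    (j : Fin 2) : IsWeakPartial Ω Ω j φ (pd j φ) := by
  intro ψ hψ
  rw [setIntegral_eq_integral_of_forall_compl_eq_zero,
    setIntegral_eq_integral_of_forall_compl_eq_zero]
  · exact integral_mul_pd hφ hφc hψ.1 hψ.2.1 j
  · intro x hx
    rw [image_eq_zero_of_notMem_tsupport fun h => hx (hψ.2.2 h), mul_zero]
  · intro x hx
    rw [pd_eq_zero_of_notMem (fun h => hx (hψ.2.2 h)), mul_zero]

/-- The field `φ eᵢ` as an element of `H¹`; it isolates row `i` of a tensor. -/
lemma exists_testField {U : Set Vec} {φ : Vec → ℝ} (hφ : IsTest U φ) (i : Fin 2) :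
    ∃ w : H1 Ω,
      (∀ᵐ x ∂(volume.restrict Ω), ∀ k, H1.val w x k = if k = i then φ x else 0) ∧
      (∀ᵐ x ∂(volume.restrict Ω), ∀ k j,
        H1.grad w x (k, j) = if k = i then pd j φ x else 0) := by
  have hv : MemLp (fun x => φ x • (EuclideanSpace.single i 1 : Vec)) 2 (volume.restrict Ω) :=
    (ContinuousLinearMap.toSpanSingleton ℝ (EuclideanSpace.single i 1 : Vec)).comp_memLp'
      hφ.memLp
  have hg : MemLp (fun x => ∑ j, pd j φ x • (EuclideanSpace.single (i, j) 1 : Mat)) 2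
      (volume.restrict Ω) :=
    memLp_finsetSum _ fun j _ =>
      (ContinuousLinearMap.toSpanSingleton ℝ (EuclideanSpace.single (i, j) 1 : Mat)).comp_memLp'
        (hφ.memLp_pd j)
  have hv' : ∀ᵐ x ∂(volume.restrict Ω), ∀ k, hv.toLp _ x k = if k = i then φ x else 0 := by
    filter_upwards [hv.coeFn_toLp] with x hx k
    rw [hx]
    simp
  have hg' : ∀ᵐ x ∂(volume.restrict Ω), ∀ k j,
      hg.toLp _ x (k, j) = if k = i then pd j φ x else 0 := by
    filter_upwards [hg.coeFn_toLp] with x hx k j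
    rw [hx]
    by_cases hk : k = i <;> fin_cases j <;>
      simp [hk, Fin.sum_univ_two]
  refine ⟨⟨WithLp.toLp 2 (hv.toLp _, hg.toLp _), fun k j => ?_⟩, hv', hg'⟩
  by_cases hk : k = i
  · refine (isWeakPartial_of_contDiff hφ.1 hφ.2.1 j).congr ?_ ?_
    · filter_upwards [hv'] with x hx
      exact (hx k).trans (if_pos hk)
    · filter_upwards [hg'] with x hx
      exact (hx k j).trans (if_pos hk)
  · refine IsWeakPartial.zero.congr ?_ ?_
    · filter_upwards [hv'] with x hx
      exact (hx k).trans (if_neg hk)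
    · filter_upwards [hg'] with x hx
      exact (hx k j).trans (if_neg hk)

/-- This expression vanishes exactly when the weak divergence identity for row `i` holds against
`φ`. -/
lemma inner_strainPair_testField {φ : Vec → ℝ} {i : Fin 2} {w : H1 Ω}
    (hv : ∀ᵐ x ∂(volume.restrict Ω), ∀ k, H1.val w x k = if k = i then φ x else 0)
    (hg : ∀ᵐ x ∂(volume.restrict Ω), ∀ k j,
      H1.grad w x (k, j) = if k = i then pd j φ x else 0)
    {p : WithLp 2 (L2 Ω Mat × L2 Ω Vec)} (hp : p ∈ symmPairs Ω) :
    inner ℝ (H1.strainPair w) p =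
      (∫ x in Ω, ∑ j, p.fst x (i, j) * pd j φ x) + ∫ x in Ω, p.snd x i * φ x := by
  rw [inner_strainPair w p (mem_symmPairs_iff_ae.1 hp)]
  congr 1
  · apply integral_congr_ae
    filter_upwards [hg] with x hx
    simp only [hx, ite_mul, zero_mul]
    rw [Finset.sum_comm]
    simp [mul_comm]
  · apply integral_congr_ae
    filter_upwards [hv] with x hx
    simp [hx, mul_comm]

/-- A pair in `L₂ × L₂` that is symmetric and annihilates the kernel of `γ_{1,nn}` belongs to
`H_nn(div, 𝒯; 𝕊)`. -/
lemma exists_mem_Hnn {q : WithLp 2 (L2 Ω Mat × L2 Ω Vec)} (hs : q ∈ symmPairs Ω)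
    (hq : ∀ w ∈ LinearMap.ker (gammaNN Ω K), inner ℝ (H1.strainPair w) q = 0) :
    ∃ τ : Hnn Ω K, ((τ : HdivT Ω K) : WithLp 2 (L2 Ω Mat × L2 Ω Vec)) = q := by
  have hdiv : q ∈ HdivT Ω K := by
    refine ⟨mem_symmPairs_iff_ae.1 hs, fun T hT i φ hφ => ?_⟩
    obtain ⟨w, hv, hg⟩ := exists_testField (Ω := Ω) hφ i
    -- Every `τ` in `H_nn` satisfies the weak divergence identity in `T`, so its pairing with `φ eᵢ`
    -- is zero.
    have hw : w ∈ LinearMap.ker (gammaNN Ω K) := by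
      rw [LinearMap.mem_ker]
      ext τ
      rw [gammaNN_apply, inner_strainPair_testField hv hg
        (mem_symmPairs_iff_ae.2 (τ : HdivT Ω K).2.1)]
      exact (eq_neg_iff_add_eq_zero.1 ((τ : HdivT Ω K).2.2 T hT i φ hφ))
    have h := hq w hw
    rw [inner_strainPair_testField hv hg hs] at h
    exact eq_neg_of_add_eq_zero_left h
  refine ⟨⟨⟨q, hdiv⟩, ?_⟩, rfl⟩
  -- Elements of `ker γ_t ∩ H¹₀` lie in the kernel of `γ_{1,nn}`, by the very definition of `H_nn`.
  rintro _ ⟨w, hw, rfl⟩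
  rw [gammaTr_apply]
  apply hq
  rw [LinearMap.mem_ker]
  ext τ
  exact τ.2 _ ⟨w, hw, rfl⟩

end test_fields

/-! ### Duality by orthogonal projection. -/

section duality

variable {Ω : Set Vec} {K : Geometry.SimplicialComplex ℝ Vec}

lemma gammaNN_le_norm1_mul (v : H1 Ω) (τ : Hnn Ω K) :
    gammaNN Ω K v τ ≤ H1.norm1 v * ‖τ‖ := by
  rw [gammaNN_apply, ← H1.norm_strainPair]
  exact real_inner_le_norm _ _

/-- Membership in `Ht` provides an extension; over an empty set the real infimum would default to
`0`. -/
lemma le_minExtNorm_iff {ρ : StrongDual ℝ (Hnn Ω K)} (hρ : ρ ∈ Ht Ω K) {c : ℝ} :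
    c ≤ minExtNorm ρ ↔ ∀ v : H1 Ω, gammaNN Ω K v = ρ → c ≤ H1.norm1 v := by
  obtain ⟨v₀, hv₀⟩ := hρ
  rw [minExtNorm, le_csInf_iff]
  · simp only [mem_ofPred_eq]
    constructor
    · exact fun h v hv => h _ ⟨v, hv, rfl⟩
    · rintro h _ ⟨v, hv, rfl⟩
      exact h v hv
  · refine ⟨0, ?_⟩
    rintro _ ⟨v, -, rfl⟩
    exact Real.sqrt_nonneg _
  · exact ⟨_, v₀, hv₀, rfl⟩

lemma div_norm_le_minExtNorm {ρ : StrongDual ℝ (Hnn Ω K)} (hρ : ρ ∈ Ht Ω K) {τ : Hnn Ω K}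
    (hτ : τ ≠ 0) : ρ τ / ‖τ‖ ≤ minExtNorm ρ := by
  rw [le_minExtNorm_iff hρ]
  rintro v rfl
  exact (div_le_iff₀ (norm_pos_iff.2 hτ)).2 (gammaNN_le_norm1_mul v τ)

/-- The component of `x` orthogonal to the closure of `N` realizes the distance of `x` to `N`. -/
lemma exists_orthogonal_part {E : Type*} [NormedAddCommGroup E] [InnerProductSpace ℝ E]
    [CompleteSpace E] {N S : Submodule ℝ E} (hNS : N ≤ S) (hS : IsClosed (S : Set E))
    {x : E} (hx : x ∈ S) :
    ∃ q ∈ S, (∀ y ∈ N, inner ℝ y q = 0) ∧ inner ℝ x q = ‖q‖ ^ 2 ∧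
      ∀ c : ℝ, (∀ y ∈ N, c ≤ ‖x - y‖) → c ≤ ‖q‖ := by
  set M := N.topologicalClosure
  have : CompleteSpace M := N.isClosed_topologicalClosure.completeSpace_coe
  have horth : ∀ y ∈ M, inner ℝ y (x - M.starProjection x) = 0 := fun y hy =>
    (Submodule.mem_orthogonal _ _).1 (Submodule.sub_starProjection_mem_orthogonal x) y hy
  have hMx := M.starProjection_apply_mem x
  refine ⟨x - M.starProjection x, sub_mem hx (N.topologicalClosure_minimal hNS hS hMx),
    fun y hy => horth y (N.le_topologicalClosure hy), ?_, fun c hc => ?_⟩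
  · rw [← real_inner_self_eq_norm_sq, inner_sub_left (x := x), horth _ hMx, sub_zero]
  -- The lower bound passes from `N` to its closure, which contains the projection of `x`.
  · have hcl : IsClosed {y | c ≤ ‖x - y‖} := isClosed_le continuous_const (by fun_prop)
    exact closure_minimal (fun y hy => hc y hy) hcl hMx

/-- The supremum in the duality formula for the minimal extension norm is attained: the orthogonal
projection of `(ε(v), v)` onto the complement of the kernel of the trace operator is the
maximizing tensor. -/
lemma exists_Hnn_maximizer {ρ : StrongDual ℝ (Hnn Ω K)} (hρ : ρ ∈ Ht Ω K) :
    ∃ τ : Hnn Ω K, ρ τ = ‖τ‖ ^ 2 ∧ minExtNorm ρ ≤ ‖τ‖ := by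
  obtain ⟨v, hv⟩ := id hρ
  obtain ⟨q, hqS, hqN, hqv, hqc⟩ := exists_orthogonal_part
    (N := (LinearMap.ker (gammaNN Ω K)).map (H1.strainPair (Ω := Ω)).toLinearMap)
    (by rintro _ ⟨w, -, rfl⟩; exact H1.strainPair_mem_symmPairs w)
    isClosed_symmPairs (H1.strainPair_mem_symmPairs v)
  obtain ⟨τ, hτ⟩ := exists_mem_Hnn hqS (fun w hw => hqN _ (Submodule.mem_map_of_mem hw))
  refine ⟨τ, ?_, ?_⟩
  · rw [← hv, gammaNN_apply, ← Hnn.norm_coe, hτ, hqv]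
  · rw [← Hnn.norm_coe, hτ]
    refine hqc _ fun y hy => ?_
    obtain ⟨w, hw, hwy⟩ := Submodule.mem_map.1 hy
    -- Shifting `v` by the kernel gives another extension of `ρ`, so distances to `N` are norms of
    -- extensions.
    have h : gammaNN Ω K (v - w) = ρ := by
      rw [map_sub, LinearMap.mem_ker.1 hw, hv]
      exact sub_zero ρ
    have h3 : H1.norm1 (v - w) = ‖H1.strainPair v - y‖ := by
      rw [← H1.norm_strainPair, map_sub, ← hwy]
      rfl
    exact h3 ▸ (le_minExtNorm_iff hρ).1 le_rfl (v - w) h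

end duality

/-! ### Constant symmetric tensors belong to `H_nn`. -/

section constants

variable {Ω : Set Vec} {K : Geometry.SimplicialComplex ℝ Vec}

lemma volume_segment (p q : Vec) : volume (segment ℝ p q) = 0 := by
  -- The span of two points has dimension at most one, hence is a null set in the plane.
  have hne : affineSpan ℝ {p, q} ≠ ⊤ := by
    intro h
    have h1 := (collinear_pair ℝ p q).finrank_le_one
    rw [← direction_affineSpan, h, AffineSubspace.direction_top, finrank_top,
      finrank_euclideanSpace_fin] at h1
    omega
  refine measure_mono_null ?_ (Measure.addHaar_affineSubspace volume _ hne)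
  rw [← convexHull_pair]
  exact convexHull_subset_affineSpan _

lemma IsPolygonalLipschitzDomain.volume_frontier (hΩ : IsPolygonalLipschitzDomain Ω) :
    volume (frontier Ω) = 0 := by
  obtain ⟨S, hS, h⟩ := hΩ.polygonal
  rw [h, measure_biUnion_null_iff hS.countable]
  exact fun p _ => volume_segment p.1 p.2

lemma IsPolygonalLipschitzDomain.isFiniteMeasure (hΩ : IsPolygonalLipschitzDomain Ω) :
    IsFiniteMeasure (volume.restrict Ω) :=
  isFiniteMeasure_restrict.2 hΩ.isBounded.measure_lt_top.ne

lemma IsPolygonalLipschitzDomain.neZero (hΩ : IsPolygonalLipschitzDomain Ω) :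
    NeZero (volume.restrict Ω) :=
  ⟨fun h => (hΩ.isOpen.measure_pos volume hΩ.isConnected.nonempty).ne'
    (Measure.restrict_eq_zero.1 h)⟩

lemma IsTriangulation.openTriangle_subset (hK : IsTriangulation K Ω) {T : Set Vec}
    (hT : T ∈ openTriangles K) : T ⊆ closure Ω := by
  obtain ⟨s, hs, -, rfl⟩ := hT
  rw [← hK.space_eq]
  exact interior_subset.trans (K.convexHull_subset_space hs)

/-- Mesh triangles are only known to lie in the closure of `Ω`; since the polygonal boundary is a
null set, `Ω` may be replaced by its closure, and then by the plane. -/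
lemma setIntegral_pd_eq_zero (hΩ : IsPolygonalLipschitzDomain Ω) {U : Set Vec}
    (hU : U ⊆ closure Ω) {φ : Vec → ℝ} (hφ : IsTest U φ) (j : Fin 2) :
    ∫ x in Ω, pd j φ x = 0 := by
  have hae : closure Ω =ᵐ[volume] Ω := by
    rw [closure_eq_self_union_frontier]
    exact union_ae_eq_left_of_ae_eq_empty (ae_eq_empty.2 hΩ.volume_frontier)
  rw [← setIntegral_congr_set hae, setIntegral_eq_integral_of_forall_compl_eq_zero,
    integral_pd_eq_zero hφ.1 hφ.2.1]
  exact fun x hx => pd_eq_zero_of_notMem (fun h => hx (hU (hφ.2.2 h))) j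

/-- The constant tensor `A`, with divergence zero. -/
def constPair (Ω : Set Vec) [IsFiniteMeasure (volume.restrict Ω)] (A : Mat) :
    WithLp 2 (L2 Ω Mat × L2 Ω Vec) :=
  WithLp.toLp 2 (Lp.const 2 (volume.restrict Ω) A, 0)

lemma constPair_fst_ae [IsFiniteMeasure (volume.restrict Ω)] (A : Mat) :
    ∀ᵐ x ∂(volume.restrict Ω), (constPair Ω A).fst x = A :=
  Lp.coeFn_const 2 (volume.restrict Ω) A

lemma constPair_ne_zero [IsFiniteMeasure (volume.restrict Ω)] [NeZero (volume.restrict Ω)]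
    {A : Mat} (hA : A ≠ 0) : constPair Ω A ≠ 0 := by
  intro h
  have h0 : Lp.const 2 (volume.restrict Ω) A = 0 :=
    congrArg (WithLp.fst (p := 2) (α := L2 Ω Mat) (β := L2 Ω Vec)) h
  have h1 := Lp.coeFn_const 2 (volume.restrict Ω) A
  rw [h0] at h1
  have h2 := h1.symm.trans (Lp.coeFn_zero Mat 2 (volume.restrict Ω))
  obtain ⟨x, hx⟩ := h2.exists
  exact hA hx

lemma inner_constPair [IsFiniteMeasure (volume.restrict Ω)] (A : Mat)
    (p : WithLp 2 (L2 Ω Mat × L2 Ω Vec)) :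
    inner ℝ (constPair Ω A) p = ∫ x in Ω, inner ℝ A (p.fst x) := by
  have h : inner ℝ (constPair Ω A) p =
      inner ℝ (constPair Ω A).fst p.fst + inner ℝ (0 : L2 Ω Vec) p.snd :=
    WithLp.prod_inner_apply _ _
  rw [h, inner_zero_left, add_zero, L2.inner_def]
  apply integral_congr_ae
  filter_upwards [constPair_fst_ae (Ω := Ω) A] with x hx
  rw [hx]

lemma constPair_mem_symmPairs [IsFiniteMeasure (volume.restrict Ω)] {A : Mat}
    (hA : ∀ i j, A (i, j) = A (j, i)) : constPair Ω A ∈ symmPairs Ω := by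
  rw [mem_symmPairs_iff_ae]
  filter_upwards [constPair_fst_ae (Ω := Ω) A] with x hx
  rw [hx]
  exact hA

/-- Green's formula with the constant field `Ψ = A`; symmetry of `A` allows `∇v` in place of `ε(v)`.
-/
lemma inner_strainPair_constPair [IsFiniteMeasure (volume.restrict Ω)] {A : Mat}
    (hA : ∀ i j, A (i, j) = A (j, i)) {v : H1 Ω} {g : Vec → Vec} (hg : IsTrace v g) :
    inner ℝ (H1.strainPair v) (constPair Ω A) =
      ∫ x in frontier Ω, ∑ i, ∑ j, g x i * A (i, j) * outerNormal Ω x j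
        ∂(Measure.hausdorffMeasure 1) := by
  rw [← hg.2 (fun _ => A) contDiff_const,
    inner_strainPair _ _ (mem_symmPairs_iff_ae.1 (constPair_mem_symmPairs hA))]
  congr 1
  · apply integral_congr_ae
    filter_upwards [constPair_fst_ae (Ω := Ω) A] with x hx
    rw [hx]
  · apply integral_congr_ae
    filter_upwards [Lp.coeFn_zero Vec 2 (volume.restrict Ω)] with x hx
    have h0 : (constPair Ω A).snd x = 0 := hx
    simp [h0, pd]

lemma constPair_mem_HdivT (hΩ : IsPolygonalLipschitzDomain Ω) (hK : IsTriangulation K Ω)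
    [IsFiniteMeasure (volume.restrict Ω)] {A : Mat} (hA : ∀ i j, A (i, j) = A (j, i)) :
    constPair Ω A ∈ HdivT Ω K := by
  refine ⟨mem_symmPairs_iff_ae.1 (constPair_mem_symmPairs hA), fun T hT i => ?_⟩
  have h : IsWeakDiv Ω T (fun j _ => A (i, j)) (fun _ => 0) := by
    intro φ hφ
    rw [integral_finsetSum _ fun j _ =>
      ((hφ.memLp_pd j).integrable one_le_two).const_mul (A (i, j))]
    simp [integral_const_mul, setIntegral_pd_eq_zero hΩ (hK.openTriangle_subset hT) hφ]
  refine h.congr (fun j => ?_) (coord_zero i)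
  filter_upwards [constPair_fst_ae (Ω := Ω) A] with x hx
  rw [hx]

/-- Normal-normal continuity holds because the boundary integral in Green's formula vanishes for
functions of zero trace. -/
lemma exists_Hnn_const (hΩ : IsPolygonalLipschitzDomain Ω) (hK : IsTriangulation K Ω)
    [IsFiniteMeasure (volume.restrict Ω)] {A : Mat} (hA : ∀ i j, A (i, j) = A (j, i)) :
    ∃ τ : Hnn Ω K,
      ((τ : HdivT Ω K) : WithLp 2 (L2 Ω Mat × L2 Ω Vec)) = constPair Ω A := by
  refine ⟨⟨⟨constPair Ω A, constPair_mem_HdivT hΩ hK hA⟩, ?_⟩, rfl⟩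
  rintro _ ⟨w, ⟨-, hw⟩, rfl⟩
  rw [gammaTr_apply, inner_strainPair_constPair hA hw]
  simp

/-- The identity tensor. -/
def idMat : Mat := WithLp.toLp 2 fun p => if p.1 = p.2 then 1 else 0

/-- The trace-free tensor `diag(1, -1)`. -/
def deviatoricMat : Mat :=
  WithLp.toLp 2 fun p => if p.1 = p.2 then (if p.1 = 0 then 1 else -1) else 0

lemma idMat_symm (i j : Fin 2) : idMat (i, j) = idMat (j, i) := by
  simp [idMat, eq_comm]

lemma deviatoricMat_symm (i j : Fin 2) : deviatoricMat (i, j) = deviatoricMat (j, i) := by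
  fin_cases i <;> fin_cases j <;> simp [deviatoricMat]

lemma deviatoricMat_ne_zero : deviatoricMat ≠ 0 := fun h => by
  simpa [deviatoricMat] using congrArg (fun A : Mat => A (0, 0)) h

lemma inner_idMat (A : Mat) : inner ℝ idMat A = trL A := by
  simp [PiLp.inner_apply, Fintype.sum_prod_type, Fin.sum_univ_two, idMat, trL]

lemma trL_deviatoricMat : trL deviatoricMat = 0 := by
  simp [trL, deviatoricMat]

end constants

/-! ### Mean-trace constraint and the supremum formula. -/

section main

variable {Ω : Set Vec} {K : Geometry.SimplicialComplex ℝ Vec}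

/-- Keeps the sets of quotients nonempty, which matters when the maximizer is zero. -/
lemma exists_Hnn_ne_zero_trace_free (hΩ : IsPolygonalLipschitzDomain Ω)
    (hK : IsTriangulation K Ω) :
    ∃ τ : Hnn Ω K, τ ≠ 0 ∧ ∫ x in Ω, trL (HdivT.val (τ : HdivT Ω K) x) = 0 := by
  have := hΩ.isFiniteMeasure
  have := hΩ.neZero
  obtain ⟨τ, hτ⟩ := exists_Hnn_const hΩ hK deviatoricMat_symm
  refine ⟨τ, ?_, ?_⟩
  · rintro rfl
    exact constPair_ne_zero deviatoricMat_ne_zero hτ.symm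
  · have h : (HdivT.val (τ : HdivT Ω K)) = (constPair Ω deviatoricMat).fst := by
      rw [← hτ]
      rfl
    rw [h]
    apply integral_eq_zero_of_ae
    filter_upwards [constPair_fst_ae (Ω := Ω) deviatoricMat] with x hx
    rw [hx, trL_deviatoricMat]
    rfl

/-- If only clamped boundary conditions are imposed, then the normal component of the trace
vanishes, so that the identity tensor is annihilated by the trace functional. -/
lemma inner_strainPair_idMat_eq_zero {Γhc Γsc Γss Γsf : Set Vec}
    [IsFiniteMeasure (volume.restrict Ω)]
    (hΓ : IsBoundaryDecomposition Ω Γhc Γsc Γss Γsf) (hs : Γss ∪ Γsf = ∅) {v : H1 Ω}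
    (hv : v ∈ H1D Ω Γhc Γsc Γss) :
    inner ℝ (H1.strainPair v) (constPair Ω idMat) = 0 := by
  obtain ⟨g, hg, hhc, hsc, -⟩ := hv
  rw [inner_strainPair_constPair idMat_symm hg]
  apply integral_eq_zero_of_ae
  obtain ⟨rfl, rfl⟩ := union_empty_iff.1 hs
  have hnull := hΓ.null
  rw [union_empty, union_empty] at hnull
  -- The boundary consists of the hard clamped part (`g = 0`), the soft clamped part (`g · n = 0`)
  -- and a set of zero length.
  have hsub : frontier Ω ⊆ (Γhc ∪ Γsc) ∪ (frontier Ω \ (Γhc ∪ Γsc)) := by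
    rw [union_sdiff_self]
    exact subset_union_right
  refine ae_restrict_of_ae_restrict_of_subset hsub ?_
  rw [ae_restrict_union_iff, ae_restrict_union_iff, Measure.restrict_eq_zero.2 hnull]
  have key : ∀ x, inner ℝ (g x) (outerNormal Ω x) =
      ∑ i, ∑ j, g x i * idMat (i, j) * outerNormal Ω x j := by
    intro x
    simp [PiLp.inner_apply, Fin.sum_univ_two, idMat, mul_comm]
  simp only [← key]
  refine ⟨⟨?_, hsc⟩, by simp⟩
  filter_upwards [hhc] with x hx
  rw [hx, inner_zero_left]
  rfl

/-- Removing the component along `a` does not increase the norm. -/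
lemma exists_sub_smul_orthogonal {E : Type*} [NormedAddCommGroup E] [InnerProductSpace ℝ E]
    (a x : E) : ∃ c : ℝ, inner ℝ a (x - c • a) = 0 ∧ ‖x - c • a‖ ≤ ‖x‖ := by
  obtain ⟨c, hc⟩ := Submodule.mem_span_singleton.1 ((ℝ ∙ a).starProjection_apply_mem x)
  refine ⟨c, ?_, ?_⟩
  · rw [hc]
    exact (Submodule.mem_orthogonal _ _).1 (Submodule.sub_starProjection_mem_orthogonal x) a
      (Submodule.mem_span_singleton_self a)
  · rw [hc, ← Submodule.starProjection_orthogonal_val]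
    exact Submodule.norm_starProjection_apply_le _ _

/-- If `ρ` vanishes at the identity tensor, then a maximizer of the duality formula can be
chosen with vanishing mean trace. -/
lemma exists_trace_free_maximizer (hΩ : IsPolygonalLipschitzDomain Ω) (hK : IsTriangulation K Ω)
    {Γhc Γsc Γss Γsf : Set Vec} (hΓ : IsBoundaryDecomposition Ω Γhc Γsc Γss Γsf)
    (hs : Γss ∪ Γsf = ∅) {ρ : StrongDual ℝ (Hnn Ω K)} (hρ : ρ ∈ HDt Ω K Γhc Γsc Γss) :
    ∃ τ σ : Hnn Ω K, ρ τ = ‖τ‖ ^ 2 ∧ minExtNorm ρ ≤ ‖τ‖ ∧ ρ σ = ρ τ ∧ ‖σ‖ ≤ ‖τ‖ ∧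
      ∫ x in Ω, trL (HdivT.val (σ : HdivT Ω K) x) = 0 := by
  have := hΩ.isFiniteMeasure
  obtain ⟨v, hv, hvρ⟩ := hρ
  obtain ⟨τ, hτ, hm⟩ := exists_Hnn_maximizer (ρ := ρ) ⟨v, hvρ⟩
  obtain ⟨I, hI⟩ := exists_Hnn_const hΩ hK idMat_symm
  have hρI : ρ I = 0 := by
    rw [← hvρ, gammaNN_apply, hI, inner_strainPair_idMat_eq_zero hΓ hs hv]
  -- The divergence of `I` is zero, so only the tensor components contribute.
  have hinner : ∀ κ : Hnn Ω K,
      inner ℝ I κ = ∫ x in Ω, trL (HdivT.val (κ : HdivT Ω K) x) := by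
    intro κ
    rw [Submodule.coe_inner, Submodule.coe_inner, hI, inner_constPair]
    simp only [inner_idMat]
    rfl
  obtain ⟨c, hc, hn⟩ := exists_sub_smul_orthogonal I τ
  refine ⟨τ, τ - c • I, hτ, hm, ?_, hn, (hinner _).symm.trans hc⟩
  rw [map_sub, map_smul, hρI, smul_zero, sub_zero]

/-- The minimal extension norm is the supremum over the nonzero tensors that satisfy `P`, if one of
these is as good as an unconstrained maximizer and there is one at all. -/
lemma isLUB_div_norm {ρ : StrongDual ℝ (Hnn Ω K)} (hρ : ρ ∈ Ht Ω K) {P : Hnn Ω K → Prop}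
    {τ σ τ₀ : Hnn Ω K} (hτ : ρ τ = ‖τ‖ ^ 2) (hm : minExtNorm ρ ≤ ‖τ‖) (hστ : ρ σ = ρ τ)
    (hn : ‖σ‖ ≤ ‖τ‖) (hσ : P σ) (h₀ : τ₀ ≠ 0) (hP₀ : P τ₀) :
    IsLUB {r : ℝ | ∃ τ : Hnn Ω K, τ ≠ 0 ∧ P τ ∧ r = ρ τ / ‖τ‖} (minExtNorm ρ) := by
  refine ⟨?_, fun b hb => ?_⟩
  · rintro _ ⟨κ, hκ, -, rfl⟩
    exact div_norm_le_minExtNorm hρ hκ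
  -- A zero maximizer gives no quotient. Then `ρ ≤ 0` on nonzero tensors, by sign change `ρ τ₀ = 0`,
  -- and the quotient at `τ₀` supplies the value `0`.
  · by_cases h : τ = 0
    · have hm0 : minExtNorm ρ ≤ 0 := by simpa [h] using hm
      have hρ₀ : ρ τ₀ = 0 := by
        have hle : ∀ κ : Hnn Ω K, κ ≠ 0 → ρ κ ≤ 0 := fun κ hκ => by
          have := (div_le_iff₀ (norm_pos_iff.2 hκ)).1 (div_norm_le_minExtNorm hρ hκ)
          exact this.trans (mul_nonpos_of_nonpos_of_nonneg hm0 (norm_nonneg _))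
        have h1 := hle τ₀ h₀
        have h2 := hle (-τ₀) (neg_ne_zero.2 h₀)
        rw [map_neg] at h2
        linarith
      exact hm0.trans (hb ⟨τ₀, h₀, hP₀, by rw [hρ₀, zero_div]⟩)
    · have hpos : 0 < ‖τ‖ := norm_pos_iff.2 h
      have hσ0 : σ ≠ 0 := by
        rintro rfl
        rw [map_zero, hτ] at hστ
        exact (pow_pos hpos 2).ne hστ
      -- Here `ρ σ / ‖σ‖ = ‖τ‖² / ‖σ‖ ≥ ‖τ‖`.
      refine hm.trans (le_trans ?_ (hb ⟨σ, hσ0, hσ, rfl⟩))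
      refine (le_div_iff₀ (norm_pos_iff.2 hσ0)).2 ?_
      rw [hστ, hτ, sq]
      exact mul_le_mul_of_nonneg_left hn hpos.le

end main

end Elast

end

theorem proposition2p4 (Ω : Set Vec) (hΩ : IsPolygonalLipschitzDomain Ω)
    (K : Geometry.SimplicialComplex ℝ Vec) (hK : IsTriangulation K Ω)
    (Γhc Γsc Γss Γsf : Set Vec) (hΓ : IsBoundaryDecomposition Ω Γhc Γsc Γss Γsf) :
    (∀ ρ ∈ Ht Ω K,
      IsLUB {r : ℝ | ∃ τ : Hnn Ω K, τ ≠ 0 ∧ r = ρ τ / ‖τ‖} (minExtNorm ρ)) ∧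
    (Γss ∪ Γsf = ∅ → ∀ ρ ∈ HDt Ω K Γhc Γsc Γss,
      IsLUB {r : ℝ | ∃ τ : Hnn Ω K, τ ≠ 0 ∧
          ∫ x in Ω, trL (HdivT.val (τ : HdivT Ω K) x) = 0 ∧ r = ρ τ / ‖τ‖}
        (minExtNorm ρ)) := by
  refine ⟨fun ρ hρ => ?_, fun hs ρ hρ => ?_⟩
  · obtain ⟨τ, hτ, hm⟩ := exists_Hnn_maximizer hρ
    obtain ⟨τ₀, h₀, -⟩ := exists_Hnn_ne_zero_trace_free hΩ hK
    simpa only [true_and] using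
      isLUB_div_norm (P := fun _ => True) hρ hτ hm rfl le_rfl trivial h₀ trivial
  · obtain ⟨τ, σ, hτ, hm, hστ, hn, hσ⟩ := exists_trace_free_maximizer hΩ hK hΓ hs hρ
    obtain ⟨τ₀, h₀, hτ₀⟩ := exists_Hnn_ne_zero_trace_free hΩ hK
    have hρ' : ρ ∈ Ht Ω K := by
      obtain ⟨v, -, hv⟩ := hρ
      exact ⟨v, hv⟩
    exact isLUB_div_norm (P := fun κ => ∫ x in Ω, trL (HdivT.val (κ : HdivT Ω K) x) = 0)
      hρ' hτ hm hστ hn hσ h₀ hτ₀
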